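/- Let $x_1,\dots,x_n\in\mathbb R^p$ be design points, $y\in\mathbb R^n$ the outputs, and $H$ an $n\times q$ real matrix of mean basis functions with full column rank $q$. For $\beta\in[0,\infty)^p$ let $R(\beta)$ be the $n\times n$ matrix with entries $\prod_{l=1}^p c_l\bigl(|x_{il}-x_{jl}|\,\beta_l\bigr)$, where each $c_l$ is either a power-exponential correlation, $c_l(u)=\exp(-u^{\alpha_l})$ with $0<\alpha_l\le 2$, or a Matérn correlation, $c_l(u)=\frac{1}{2^{\alpha_l-1}\Gamma(\alpha_l)}u^{\alpha_l}\mathcal K_{\alpha_l}(u)$ for $u>0$ and $c_l(0)=1$, with $\alpha_l>0$ and $\mathcal K_\alpha$ the modified Bessel function of the second kind. (The range parameters are $\gamma_l=1/\beta_l$.) Let $$L(\beta\mid y)=\int_{\mathbb R^q}\int_0^\infty \mathrm{MN}\bigl(y;\,H\theta,\,\sigma^2R(\beta)\bigr)\,\frac{1}{\sigma^2}\,d\sigma^2\,d\theta$$ be the marginal likelihood, where $\mathrm{MN}(y;\mu,\Sigma)$ is the multivariate normal density at $y$, and let $$\pi^{JR}(\beta)=C_0\Bigl(\sum_{l=1}^pC_l\beta_l\Bigr)^a\exp\Bigl\{-b\sum_{l=1}^pC_l\beta_l\Bigr\},\qquad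 C_0=\frac{(p-1)!\,b^{a+p}\prod_{l=1}^pC_l}{\Gamma(a+p)},$$ be the jointly robust (JR) prior with $a>0$, $b>0$ and all $C_l>0$. The marginal posterior of the inverse range parameters $\beta$ is, up to its normalizing constant, $\beta\mapsto L(\beta\mid y)\,\pi^{JR}(\beta)$. Assume that neither $\mathbf 1_n$ nor $y$ lies in the column space of $H$. Let $E$ be a nonempty proper subset of $\{1,\dots,p\}$ such that the design points remain pairwise distinct when the coordinates in $E$ are deleted (this holds for every such $E$ in a Latin hypercube design). Let $\beta^0$ satisfy $\beta^0_l=0$ for $l\in E$ and $\beta^0_l>0$ for $l\notin E$. Then $L(\beta\mid y)\,\pi^{JR}(\beta)$ converges, as $\beta\to\beta^0$ in $[0,\infty)^p$, to $L(\beta^0\mid y)\,\pi^{JR}(\beta^0)$, and this limit is finite and strictly positive. If moreover the posterior is proper, that is, $\int_{(0,\infty)^p}L(\beta\mid y)\,\pi^{JR}(\beta)\,d\beta<\infty$, then the normalized marginal posterior density likewise converges, as $\beta\to\beta^0$ in $[0,\infty)^p$, to a finite and strictly positive limit, namely its value at $\beta^0$. -/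

import Mathlib

open MeasureTheory Set Filter Topology
open scoped ENNReal

noncomputable section

/-- The modified Bessel function of the second kind `K_ν (u)` for `u > 0`, through its
standard integral representation `K_ν (u) = ∫_0^∞ exp (-u cosh t) cosh (ν t) dt`. -/
def besselK (ν u : ℝ) : ℝ :=
  ∫ t in Ioi (0 : ℝ), Real.exp (-(u * Real.cosh t)) * Real.cosh (ν * t)

/-- The two classes of one-dimensional correlation functions. -/
inductive CorrKind where
  | powerExp
  | matern

/-- The admissible roughness parameters: `0 < α ≤ 2` for the power exponential correlation,
`0 < α` for the Matérn correlation. -/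
def CorrKind.Admissible : CorrKind → ℝ → Prop
  | .powerExp, α => 0 < α ∧ α ≤ 2
  | .matern, α => 0 < α

/-- The one-dimensional correlation as a function of `u = d / γ = d * β ≥ 0`. The Matérn
correlation at `u = 0` has its limiting value `1`, as every correlation function does. -/
def CorrKind.corr : CorrKind → ℝ → ℝ → ℝ
  | .powerExp, α, u => Real.exp (-(u ^ α))
  | .matern, α, u =>
      if u = 0 then 1
      else 1 / ((2 : ℝ) ^ (α - 1) * Real.Gamma α) * u ^ α * besselK α u

/-- The correlation matrix `R = R_1 ∘ ... ∘ R_p` of the product correlation at the design points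
`x 0, ..., x (n - 1)`, with inverse range parameters `β`. -/
def corrMatrix {n p : ℕ} (kind : Fin p → CorrKind) (α : Fin p → ℝ) (x : Fin n → Fin p → ℝ)
    (β : Fin p → ℝ) : Matrix (Fin n) (Fin n) ℝ :=
  Matrix.of fun i j => ∏ l, (kind l).corr (α l) (|x i l - x j l| * β l)

/-- The density at `y` of the multivariate normal distribution with mean `μ` and covariance
matrix `S`. -/
def mvnDensity {n : ℕ} (μ : Fin n → ℝ) (S : Matrix (Fin n) (Fin n) ℝ) (y : Fin n → ℝ) : ℝ :=
  (Real.sqrt ((2 * Real.pi) ^ n * S.det))⁻¹ *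
    Real.exp (-((y - μ) ⬝ᵥ S⁻¹.mulVec (y - μ)) / 2)

/-- The marginal likelihood: the `MN (H θ, σ² R)` likelihood of the observations `y`,
with the mean parameters `θ` and the variance `s = σ²` integrated out against the
prior `dθ dσ² / σ²`. -/
def marginalLikelihood {n p q : ℕ} (kind : Fin p → CorrKind) (α : Fin p → ℝ)
    (x : Fin n → Fin p → ℝ) (H : Matrix (Fin n) (Fin q) ℝ) (y : Fin n → ℝ)
    (β : Fin p → ℝ) : ℝ≥0∞ :=
  ∫⁻ θ : Fin q → ℝ, ∫⁻ s in Ioi (0 : ℝ),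
    ENNReal.ofReal (mvnDensity (H.mulVec θ) (s • corrMatrix kind α x β) y * s⁻¹)

/-- The jointly robust prior density of the inverse range parameters `β`. -/
def jrPrior {p : ℕ} (a b : ℝ) (C : Fin p → ℝ) (β : Fin p → ℝ) : ℝ :=
  ((p - 1).factorial * b ^ (a + p) * (∏ l, C l) / Real.Gamma (a + p)) *
    (∑ l, C l * β l) ^ a * Real.exp (-b * ∑ l, C l * β l)

/-- The marginal posterior of `β` up to its normalizing constant: marginal likelihood times
the jointly robust prior. -/
def unnormalizedPosterior {n p q : ℕ} (kind : Fin p → CorrKind) (α : Fin p → ℝ)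
    (x : Fin n → Fin p → ℝ) (H : Matrix (Fin n) (Fin q) ℝ) (y : Fin n → ℝ)
    (a b : ℝ) (C : Fin p → ℝ) (β : Fin p → ℝ) : ℝ≥0∞ :=
  marginalLikelihood kind α x H y β * ENNReal.ofReal (jrPrior a b C β)

/-- The normalizing constant of the marginal posterior, over the parameter space `β_l > 0`. -/
def posteriorMass {n p q : ℕ} (kind : Fin p → CorrKind) (α : Fin p → ℝ)
    (x : Fin n → Fin p → ℝ) (H : Matrix (Fin n) (Fin q) ℝ) (y : Fin n → ℝ)
    (a b : ℝ) (C : Fin p → ℝ) : ℝ≥0∞ :=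
  ∫⁻ β in {β : Fin p → ℝ | ∀ l, 0 < β l}, unnormalizedPosterior kind α x H y a b C β

/-- The normalized marginal posterior density of `β`. -/
def marginalPosterior {n p q : ℕ} (kind : Fin p → CorrKind) (α : Fin p → ℝ)
    (x : Fin n → Fin p → ℝ) (H : Matrix (Fin n) (Fin q) ℝ) (y : Fin n → ℝ)
    (a b : ℝ) (C : Fin p → ℝ) (β : Fin p → ℝ) : ℝ≥0∞ :=
  unnormalizedPosterior kind α x H y a b C β / posteriorMass kind α x H y a b C

end

/-! Letting some `β l` tend to `0` does not make the correlation matrix singular: the corresponding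
factors tend to `1`, and the coordinates outside `E` still separate the design points. So `β₀` is a
regular point of the likelihood, although it lies on the boundary of the orthant.

Nonsingularity (`posDef_corrMatrix`) rests on strict positive definiteness of the one-dimensional
kernels (`isStrictPosDefKernel_corr`). Gaussian kernels have it by a power series and Vandermonde
argument, Matérn kernels as Gaussian mixtures, and power-exponential kernels with exponent below `2`
as exponentials of such mixtures. A single coordinate may repeat among the design points, so each
factor is bounded below by a multiple of its equality relation; multiplying these bounds in the
Schur order leaves a positive multiple of the identity.

Near a positive definite matrix the determinant and the inverse quadratic form are bounded below. As
`y` is outside the column space of `H`, the squared residual is at least `κ * (1 + ‖θ‖ ^ 2)` and `q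
< n`, so an integrable function dominates the integrand and the likelihood is continuous
(`matrixLikelihood_lt_top_and_tendsto`). The prior is continuous and is positive at `β₀` because `E`
is proper. The positive limit also makes the total mass nonzero, so a finite mass allows
normalization. -/

theorem Real.hasSum_pow_div_factorial (x : ℝ) :
    HasSum (fun k : ℕ => x ^ k / k.factorial) (Real.exp x) := by
  rw [Real.exp_eq_exp_ℝ]
  exact NormedSpace.expSeries_div_hasSum_exp x

/-! ### Positive definite matrices: Schur products, entrywise exponential, coercivity. -/

namespace Matrix

variable {m : Type*} [Fintype m]

theorem dotProduct_mulVec_eq_sum (A : Matrix m m ℝ) (c : m → ℝ) :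
    c ⬝ᵥ A *ᵥ c = ∑ i, ∑ j, c i * c j * A i j := by
  simp only [dotProduct, mulVec, Finset.mul_sum]
  exact Finset.sum_congr rfl fun i _ => Finset.sum_congr rfl fun j _ => by ring

theorem posSemidef_iff_sum {A : Matrix m m ℝ} :
    A.PosSemidef ↔ (∀ i j, A i j = A j i) ∧ ∀ c : m → ℝ, 0 ≤ ∑ i, ∑ j, c i * c j * A i j := by
  rw [posSemidef_iff_dotProduct_mulVec]
  simp only [star_trivial, dotProduct_mulVec_eq_sum]
  refine and_congr_left fun _ => ?_
  rw [IsHermitian, ← ext_iff]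
  exact forall_congr' fun i => forall_congr' fun j => by simp [eq_comm]

theorem posDef_iff_sum {A : Matrix m m ℝ} :
    A.PosDef ↔ (∀ i j, A i j = A j i) ∧
      ∀ c : m → ℝ, c ≠ 0 → 0 < ∑ i, ∑ j, c i * c j * A i j := by
  rw [posDef_iff_dotProduct_mulVec]
  simp only [star_trivial, dotProduct_mulVec_eq_sum]
  refine and_congr_left fun _ => ?_
  rw [IsHermitian, ← ext_iff]
  exact forall_congr' fun i => forall_congr' fun j => by simp [eq_comm]

theorem PosSemidef.of_tendsto {ι : Type*} {l : Filter ι} [l.NeBot] {A : ι → Matrix m m ℝ}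
    {B : Matrix m m ℝ} (hA : ∀ᶠ k in l, (A k).PosSemidef)
    (h : ∀ i j, Tendsto (fun k => A k i j) l (𝓝 (B i j))) : B.PosSemidef := by
  rw [posSemidef_iff_sum]
  constructor
  · intro i j
    refine tendsto_nhds_unique_of_eventuallyEq (h i j) (h j i) ?_
    filter_upwards [hA] with k hk using (posSemidef_iff_sum.1 hk).1 i j
  · intro c
    refine ge_of_tendsto (f := fun k => ∑ i, ∑ j, c i * c j * A k i j) (x := l) ?_ ?_
    · exact tendsto_finsetSum _ fun i _ => tendsto_finsetSum _ fun j _ => (h i j).const_mul _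
    · filter_upwards [hA] with k hk using (posSemidef_iff_sum.1 hk).2 c

theorem posSemidef_of_one : (of fun _ _ => 1 : Matrix m m ℝ).PosSemidef := by
  rw [posSemidef_iff_sum]
  refine ⟨fun _ _ => rfl, fun c => ?_⟩
  simp only [of_apply, mul_one, ← Finset.sum_mul_sum]
  exact mul_self_nonneg _

theorem PosSemidef.of_mul {m : Type*} {A B : Matrix m m ℝ} (hA : A.PosSemidef) (hB : B.PosSemidef) :
    (of fun i j => A i j * B i j).PosSemidef :=
  hA.hadamard hB

theorem PosSemidef.of_pow {A : Matrix m m ℝ} (hA : A.PosSemidef) (k : ℕ) :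
    (of fun i j => A i j ^ k).PosSemidef := by
  induction k with
  | zero => simpa using posSemidef_of_one
  | succ k ih =>
    simp only [pow_succ]
    exact ih.of_mul hA

theorem hasSum_quadraticForm_exp (A : Matrix m m ℝ) (c : m → ℝ) :
    HasSum (fun k : ℕ => (∑ i, ∑ j, c i * c j * A i j ^ k) / k.factorial)
      (∑ i, ∑ j, c i * c j * Real.exp (A i j)) := by
  simp only [Finset.sum_div, mul_div_assoc]
  exact hasSum_sum fun i _ => hasSum_sum fun j _ =>
    (Real.hasSum_pow_div_factorial (A i j)).mul_left _

/-- The entrywise exponential of a positive definite matrix is positive definite. -/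
theorem PosDef.of_exp {A : Matrix m m ℝ} (hA : A.PosDef) :
    (of fun i j => Real.exp (A i j)).PosDef := by
  have h := posDef_iff_sum.1 hA
  rw [posDef_iff_sum]
  refine ⟨fun i j => by simp [h.1 i j], fun c hc => ?_⟩
  -- The linear term of the exponential series is already strictly positive; the other terms come
  -- from Schur powers and are nonnegative.
  refine lt_of_lt_of_le ?_ (le_hasSum (hasSum_quadraticForm_exp A c) 1 fun k _ => ?_)
  · simpa using h.2 c hc
  · exact div_nonneg ((posSemidef_iff_sum.1 (hA.posSemidef.of_pow k)).2 c) (by positivity)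

theorem isCompact_dotProduct_self_eq_one : IsCompact {v : m → ℝ | v ⬝ᵥ v = 1} := by
  refine Metric.isCompact_of_isClosed_isBounded
    (isClosed_eq (by simp only [dotProduct]; fun_prop) continuous_const) ?_
  refine (Metric.isBounded_closedBall (x := (0 : m → ℝ)) (r := 1)).subset fun v hv => ?_
  rw [mem_closedBall_zero_iff, pi_norm_le_iff_of_nonneg zero_le_one]
  intro i
  have : v i * v i ≤ v ⬝ᵥ v :=
    Finset.single_le_sum (f := fun i => v i * v i) (fun _ _ => mul_self_nonneg _)
      (Finset.mem_univ i)
  rw [mem_ofPred_eq] at hv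
  rw [Real.norm_eq_abs]
  exact abs_le_one_iff_mul_self_le_one.2 (this.trans hv.le)

/-- Near a positive definite matrix the quadratic forms are uniformly coercive. -/
theorem PosDef.exists_eventually_le {A : Matrix m m ℝ} (hA : A.PosDef) :
    ∃ c > 0, ∀ᶠ B in 𝓝 A, ∀ v : m → ℝ, c * (v ⬝ᵥ v) ≤ v ⬝ᵥ B *ᵥ v := by
  set K := {v : m → ℝ | v ⬝ᵥ v = 1} with hK
  have hKc : IsCompact K := isCompact_dotProduct_self_eq_one
  have hcont : Continuous fun z : Matrix m m ℝ × (m → ℝ) => z.2 ⬝ᵥ z.1 *ᵥ z.2 :=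
    continuous_snd.dotProduct (continuous_fst.matrix_mulVec continuous_snd)
  have hne : ∀ v ∈ K, v ≠ 0 := by
    rintro v hv rfl
    simp [hK] at hv
  obtain ⟨c, hc, hcK⟩ : ∃ c > 0, ∀ v ∈ K, c < v ⬝ᵥ A *ᵥ v := by
    rcases K.eq_empty_or_nonempty with h | h
    · exact ⟨1, one_pos, by simp [h]⟩
    · obtain ⟨v, hv, hmin⟩ := hKc.exists_isMinOn h
        (f := fun v => v ⬝ᵥ A *ᵥ v) (hcont.comp (Continuous.prodMk_right A)).continuousOn
      have hpos : 0 < v ⬝ᵥ A *ᵥ v := by simpa using hA.dotProduct_mulVec_pos (hne v hv)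
      exact ⟨_, half_pos hpos, fun w hw => (half_lt_self hpos).trans_le (hmin hw)⟩
  refine ⟨c, hc, ?_⟩
  -- The strict margin below the minimum at `A` and compactness of the sphere give one neighbourhood
  -- that serves all unit vectors.
  have hev : ∀ᶠ B in 𝓝 A, ∀ v ∈ K, c < v ⬝ᵥ B *ᵥ v :=
    hKc.eventually_forall_of_forall_eventually fun v hv =>
      (hcont.tendsto (A, v)).eventually (lt_mem_nhds (hcK v hv))
  filter_upwards [hev] with B hB v
  rcases eq_or_ne v 0 with rfl | hv
  · simp
  have hvv : 0 < v ⬝ᵥ v := by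
    have := dotProduct_star_self_pos_iff.2 hv
    simpa using this
  set r := √(v ⬝ᵥ v) with hr
  have hr0 : 0 < r := Real.sqrt_pos.2 hvv
  have hrr : v ⬝ᵥ v = r * r := (Real.mul_self_sqrt hvv.le).symm
  have hmem : r⁻¹ • v ∈ K := by
    simp only [hK, mem_ofPred_eq, smul_dotProduct, dotProduct_smul, hrr, smul_eq_mul]
    field_simp
  have := hB _ hmem
  simp only [mulVec_smul, smul_dotProduct, dotProduct_smul, smul_eq_mul] at this
  rw [hrr]
  have h2 : v ⬝ᵥ B *ᵥ v = r * r * (r⁻¹ * (r⁻¹ * (v ⬝ᵥ B *ᵥ v))) := by field_simp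
  rw [h2, mul_comm c]
  exact mul_le_mul_of_nonneg_left this.le (by positivity)

theorem PosDef.exists_posSemidef_sub [DecidableEq m] {A : Matrix m m ℝ} (hA : A.PosDef) :
    ∃ c : ℝ, 0 < c ∧ (A - c • (1 : Matrix m m ℝ)).PosSemidef := by
  obtain ⟨c, hc, h⟩ := hA.exists_eventually_le
  refine ⟨c, hc, posSemidef_iff_dotProduct_mulVec.2
    ⟨hA.isHermitian.sub (isHermitian_one.smul (IsSelfAdjoint.all c)), fun v => ?_⟩⟩
  have := h.self_of_nhds v
  simp only [star_trivial, sub_mulVec, smul_mulVec, one_mulVec, dotProduct_sub, dotProduct_smul,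
    smul_eq_mul]
  linarith

/-- Write `A` as a positive semidefinite matrix plus `c • 1`. The first summand stays semidefinite
after the Schur product with `B`; the second becomes a positive diagonal. -/
theorem PosDef.hadamard_posSemidef [DecidableEq m] {A B : Matrix m m ℝ} (hA : A.PosDef)
    (hB : B.PosSemidef) (hd : ∀ i, 0 < B i i) :
    (of fun i j => A i j * B i j).PosDef := by
  obtain ⟨c, hc, h⟩ := hA.exists_posSemidef_sub
  have h1 := h.of_mul hB
  have h2 : (diagonal fun i => c * B i i).PosDef :=
    posDef_diagonal_iff.2 fun i => mul_pos hc (hd i)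
  have := PosDef.posSemidef_add h1 h2
  convert this using 1
  ext i j
  by_cases hij : i = j
  · subst hij
    simp only [of_apply, add_apply, sub_apply, smul_apply, one_apply_eq, diagonal_apply_eq,
      smul_eq_mul]
    ring
  · simp [hij]

end Matrix

/-! ### Strictly positive definite kernels: Gaussians and their mixtures. -/

/-- A function of the distance on the real line whose kernel matrices at pairwise distinct points
are positive definite. -/
def IsStrictPosDefKernel (f : ℝ → ℝ) : Prop :=
  ∀ (m : ℕ) (z : Fin m → ℝ), Function.Injective z →
    (Matrix.of fun i j => f |z i - z j|).PosDef

/-- Absorb `exp (-(s * z i ^ 2))` into the coefficients and expand the remaining `exp (2 * s * (z i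
* z j))`. The quadratic form becomes a positively weighted sum of squared moments, and by
Vandermonde not all moments vanish at distinct points. -/
theorem isStrictPosDefKernel_gaussian {s : ℝ} (hs : 0 < s) :
    IsStrictPosDefKernel fun u => Real.exp (-(s * u ^ 2)) := by
  intro m z hz
  rw [Matrix.posDef_iff_sum]
  refine ⟨fun i j => by simp only [Matrix.of_apply, abs_sub_comm], fun c hc => ?_⟩
  set d : Fin m → ℝ := fun i => c i * Real.exp (-(s * z i ^ 2)) with hd
  have hsum : HasSum (fun k : ℕ => (2 * s) ^ k / k.factorial * (∑ i, d i * z i ^ k) ^ 2)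
      (∑ i, ∑ j, c i * c j * Real.exp (-(s * |z i - z j| ^ 2))) := by
    convert hasSum_sum (s := Finset.univ) (f := fun i (k : ℕ) => ∑ j, d i * d j *
      ((2 * s * (z i * z j)) ^ k / k.factorial)) fun i _ => hasSum_sum fun j _ =>
      (Real.hasSum_pow_div_factorial (2 * s * (z i * z j))).mul_left (d i * d j) using 1
    · funext k
      rw [sq, Finset.sum_mul_sum, Finset.mul_sum]
      refine Finset.sum_congr rfl fun i _ => ?_
      rw [Finset.mul_sum]
      refine Finset.sum_congr rfl fun j _ => ?_
      ring
    · refine Finset.sum_congr rfl fun i _ => Finset.sum_congr rfl fun j _ => ?_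
      simp only [hd, sq_abs]
      rw [show -(s * (z i - z j) ^ 2) = -(s * z i ^ 2) + -(s * z j ^ 2) + 2 * s * (z i * z j) by
        ring, Real.exp_add, Real.exp_add]
      ring
  have hnn : ∀ k : ℕ, 0 ≤ (2 * s) ^ k / k.factorial * (∑ i, d i * z i ^ k) ^ 2 := fun k => by
    positivity
  refine lt_of_le_of_ne (hsum.nonneg hnn) fun h0 => hc ?_
  simp only [Matrix.of_apply] at h0
  rw [← h0] at hsum
  have hz0 := (hasSum_zero_iff_of_nonneg hnn).1 hsum
  have hd0 : d = 0 := Matrix.eq_zero_of_forall_pow_sum_mul_pow_eq_zero hz fun k => by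
    have hk := congrFun hz0 k
    have hpos : (2 * s) ^ (k : ℕ) / ((k : ℕ).factorial : ℝ) ≠ 0 := by positivity
    simpa [hpos] using hk
  funext i
  have := congrFun hd0 i
  simpa [hd] using this

theorem IsStrictPosDefKernel.setIntegral_gaussian {S : Set ℝ} (hS : MeasurableSet S)
    (hS0 : volume S ≠ 0) {w σ : ℝ → ℝ} (hw : ∀ t ∈ S, 0 < w t) (hσ : ∀ t ∈ S, 0 < σ t)
    (hint : ∀ u, 0 ≤ u → IntegrableOn (fun t => w t * Real.exp (-(σ t * u ^ 2))) S) :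
    IsStrictPosDefKernel fun u => ∫ t in S, w t * Real.exp (-(σ t * u ^ 2)) := by
  intro m z hz
  rw [Matrix.posDef_iff_sum]
  refine ⟨fun i j => by simp only [Matrix.of_apply, abs_sub_comm], fun c hc => ?_⟩
  have hI : ∀ i j, IntegrableOn
      (fun t => c i * c j * (w t * Real.exp (-(σ t * |z i - z j| ^ 2)))) S :=
    fun i j => (hint _ (abs_nonneg _)).const_mul _
  have hpos : ∀ t ∈ S, 0 < ∑ i, ∑ j, c i * c j * (w t * Real.exp (-(σ t * |z i - z j| ^ 2))) := by
    intro t ht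
    have h := (Matrix.posDef_iff_sum.1 (isStrictPosDefKernel_gaussian (hσ t ht) m z hz)).2 c hc
    refine (mul_pos (hw t ht) h).trans_eq ?_
    rw [Finset.mul_sum]
    refine Finset.sum_congr rfl fun i _ => ?_
    rw [Finset.mul_sum]
    exact Finset.sum_congr rfl fun j _ => by rw [Matrix.of_apply]; ring
  have heq : ∑ i, ∑ j, c i * c j * (Matrix.of fun i j => ∫ t in S,
      w t * Real.exp (-(σ t * |z i - z j| ^ 2))) i j =
      ∫ t in S, ∑ i, ∑ j, c i * c j * (w t * Real.exp (-(σ t * |z i - z j| ^ 2))) := by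
    rw [integral_finsetSum _ fun i _ => integrable_finsetSum _ fun j _ => hI i j]
    refine Finset.sum_congr rfl fun i _ => ?_
    rw [integral_finsetSum _ fun j _ => hI i j]
    refine Finset.sum_congr rfl fun j _ => ?_
    rw [integral_const_mul, Matrix.of_apply]
  rw [heq, setIntegral_pos_iff_support_of_nonneg_ae]
  · rw [inter_eq_right.2 fun t ht => Function.mem_support.2 (hpos t ht).ne']
    exact pos_iff_ne_zero.2 hS0
  · filter_upwards [ae_restrict_mem hS] with t ht using (hpos t ht).le
  · exact integrable_finsetSum _ fun i _ => integrable_finsetSum _ fun j _ => hI i j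

/-! ### Power-exponential correlations. -/

theorem integrableOn_one_sub_exp_mul_rpow {γ w : ℝ} (h0 : 0 < γ) (h1 : γ < 1) (hw : 0 ≤ w) :
    IntegrableOn (fun t => (1 - Real.exp (-(w * t))) * t ^ (-1 - γ)) (Ioi 0) := by
  rw [← Ioc_union_Ioi_eq_Ioi zero_le_one]
  have hmeas : Measurable fun t => (1 - Real.exp (-(w * t))) * t ^ (-1 - γ) := by fun_prop
  have hnn : ∀ t : ℝ, 0 < t → 0 ≤ 1 - Real.exp (-(w * t)) := fun t ht =>
    sub_nonneg.2 (Real.exp_le_one_iff.2 (neg_nonpos.2 (by positivity)))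
  refine IntegrableOn.union ?_ ?_
  · have hi : IntegrableOn (fun t : ℝ => w * t ^ (-γ)) (Ioc 0 1) :=
      ((intervalIntegrable_iff_integrableOn_Ioc_of_le zero_le_one).1
        (intervalIntegral.intervalIntegrable_rpow' (by linarith))).const_mul w
    refine Integrable.mono' hi hmeas.aestronglyMeasurable ?_
    filter_upwards [ae_restrict_mem measurableSet_Ioc] with t ht
    have hp : 0 < t ^ (-1 - γ) := Real.rpow_pos_of_pos ht.1 _
    rw [Real.norm_of_nonneg (mul_nonneg (hnn t ht.1) hp.le)]
    have : t ^ (-γ) = t * t ^ (-1 - γ) := by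
      rw [show -γ = 1 + (-1 - γ) by ring, Real.rpow_add ht.1, Real.rpow_one]
    rw [this, ← mul_assoc]
    refine mul_le_mul_of_nonneg_right ?_ hp.le
    linarith [Real.add_one_le_exp (-(w * t))]
  · have hi : IntegrableOn (fun t : ℝ => t ^ (-1 - γ)) (Ioi 1) :=
      integrableOn_Ioi_rpow_of_lt (by linarith) one_pos
    refine Integrable.mono' hi hmeas.aestronglyMeasurable ?_
    filter_upwards [ae_restrict_mem measurableSet_Ioi] with t ht
    have ht0 : 0 < t := one_pos.trans ht
    have hp : 0 < t ^ (-1 - γ) := Real.rpow_pos_of_pos ht0 _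
    rw [Real.norm_of_nonneg (mul_nonneg (hnn t ht0) hp.le)]
    exact mul_le_of_le_one_left hp.le (by linarith [Real.exp_pos (-(w * t))])

theorem integral_one_sub_exp_mul_rpow_pos {γ : ℝ} (h0 : 0 < γ) (h1 : γ < 1) :
    0 < ∫ t in Ioi (0 : ℝ), (1 - Real.exp (-t)) * t ^ (-1 - γ) := by
  have hi := integrableOn_one_sub_exp_mul_rpow h0 h1 zero_le_one
  simp only [one_mul] at hi
  have hpos : ∀ t ∈ Ioi (0 : ℝ), 0 < (1 - Real.exp (-t)) * t ^ (-1 - γ) := fun t ht =>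
    mul_pos (sub_pos.2 (Real.exp_lt_one_iff.2 (neg_lt_zero.2 ht))) (Real.rpow_pos_of_pos ht _)
  rw [setIntegral_pos_iff_support_of_nonneg_ae _ hi]
  · rw [inter_eq_right.2 fun t ht => Function.mem_support.2 (hpos t ht).ne']
    simp
  · filter_upwards [ae_restrict_mem measurableSet_Ioi] with t ht using (hpos t ht).le

/-- Rescaling `t` by `w` extracts the power. With `w = u ^ 2` and `γ = α / 2` this represents `u ^
α` as a mixture of the functions `1 - exp (-(t * u ^ 2))`. -/
theorem integral_one_sub_exp_mul_rpow {γ w : ℝ} (h0 : 0 < γ) (hw : 0 ≤ w) :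
    ∫ t in Ioi (0 : ℝ), (1 - Real.exp (-(w * t))) * t ^ (-1 - γ) =
      w ^ γ * ∫ t in Ioi (0 : ℝ), (1 - Real.exp (-t)) * t ^ (-1 - γ) := by
  rcases hw.eq_or_lt with rfl | hw
  · simp [Real.zero_rpow h0.ne']
  have h := integral_comp_mul_left_Ioi (fun t => (1 - Real.exp (-t)) * t ^ (-1 - γ)) 0 hw
  rw [mul_zero, smul_eq_mul] at h
  have h2 : ∫ t in Ioi (0 : ℝ), (1 - Real.exp (-(w * t))) * t ^ (-1 - γ) =
      w ^ (1 + γ) * ∫ t in Ioi (0 : ℝ), (1 - Real.exp (-(w * t))) * (w * t) ^ (-1 - γ) := by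
    rw [← integral_const_mul]
    refine setIntegral_congr_fun measurableSet_Ioi fun t ht => ?_
    rw [Real.mul_rpow hw.le (le_of_lt ht)]
    have : w ^ (1 + γ) * w ^ (-1 - γ) = 1 := by
      rw [← Real.rpow_add hw, show 1 + γ + (-1 - γ) = 0 by ring, Real.rpow_zero]
    linear_combination (-(1 - Real.exp (-(w * t))) * t ^ (-1 - γ)) * this
  rw [h2, h, ← mul_assoc, Real.rpow_add hw, Real.rpow_one]
  field_simp

/-- For a weight of finite mass the exponent splits into a constant plus a Gaussian mixture, so the
kernel is a positive multiple of the entrywise exponential of a positive definite matrix. -/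
theorem IsStrictPosDefKernel.exp_neg_setIntegral {S : Set ℝ} (hS : MeasurableSet S)
    (hS0 : volume S ≠ 0) (hpos : S ⊆ Ioi 0) {w : ℝ → ℝ} (hw : ∀ t ∈ S, 0 < w t)
    (hint : IntegrableOn w S) :
    IsStrictPosDefKernel fun u => Real.exp (-∫ t in S, (1 - Real.exp (-(t * u ^ 2))) * w t) := by
  have hI : ∀ u : ℝ, IntegrableOn (fun t => w t * Real.exp (-(t * u ^ 2))) S := by
    intro u
    refine Integrable.mul_bdd (c := 1) hint (by fun_prop) ?_
    filter_upwards [ae_restrict_mem hS] with t ht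
    rw [Real.norm_of_nonneg (Real.exp_pos _).le, Real.exp_le_one_iff, neg_nonpos]
    have : 0 < t := hpos ht
    positivity
  intro m z hz
  have hg := ((IsStrictPosDefKernel.setIntegral_gaussian hS hS0 hw (σ := fun t => t)
    (fun t ht => hpos ht) fun u _ => hI u) m z hz).of_exp
  have := hg.smul (Real.exp_pos (-∫ t in S, w t))
  convert this using 1
  ext i j
  simp only [Matrix.of_apply, Matrix.smul_apply, smul_eq_mul]
  rw [← Real.exp_add, neg_add_eq_sub, ← integral_sub (hI _) hint, ← integral_neg]
  congr 1
  exact integral_congr_ae (Eventually.of_forall fun t => by ring)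

theorem isStrictPosDefKernel_exp_neg_rpow_of_lt_two {α : ℝ} (h0 : 0 < α) (h2 : α < 2) :
    IsStrictPosDefKernel fun u => Real.exp (-(u ^ α)) := by
  have hγ0 : 0 < α / 2 := by linarith
  have hγ1 : α / 2 < 1 := by linarith
  set k := ∫ t in Ioi (0 : ℝ), (1 - Real.exp (-t)) * t ^ (-1 - α / 2) with hk
  have hkpos : 0 < k := integral_one_sub_exp_mul_rpow_pos hγ0 hγ1
  set w : ℝ → ℝ := fun t => t ^ (-1 - α / 2) / k with hw
  have hwpos : ∀ t, 0 < t → 0 < w t := fun t ht => div_pos (Real.rpow_pos_of_pos ht _) hkpos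
  have hwint : ∀ ε, 0 < ε → IntegrableOn w (Ioi ε) := fun ε hε =>
    (integrableOn_Ioi_rpow_of_lt (by linarith) hε).div_const k
  set F : ℝ → ℝ → ℝ := fun u t => (1 - Real.exp (-(t * u ^ 2))) * w t with hF
  have hFint : ∀ u, IntegrableOn (F u) (Ioi 0) := fun u => by
    have := (integrableOn_one_sub_exp_mul_rpow hγ0 hγ1 (sq_nonneg u)).div_const k
    refine this.congr (Eventually.of_forall fun t => ?_)
    simp only [hF, hw, mul_comm t, mul_div_assoc]
  have hFeq : ∀ u, 0 ≤ u → u ^ α = (∫ t in Ioc 0 1, F u t) + ∫ t in Ioi 1, F u t := by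
    intro u hu
    rw [← setIntegral_union (Ioc_disjoint_Ioi le_rfl) measurableSet_Ioi
      ((hFint u).mono_set Ioc_subset_Ioi_self)
      ((hFint u).mono_set (Ioi_subset_Ioi zero_le_one)), Ioc_union_Ioi_eq_Ioi zero_le_one]
    have h := integral_one_sub_exp_mul_rpow hγ0 (sq_nonneg u)
    rw [← hk] at h
    have h3 : ∫ t in Ioi 0, F u t = (u ^ 2) ^ (α / 2) := by
      rw [eq_comm, ← mul_div_cancel_right₀ ((u ^ 2) ^ (α / 2)) hkpos.ne', ← h, ← integral_div]
      simp only [hF, hw, mul_comm (u ^ 2), mul_div_assoc]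
    rw [h3, ← Real.rpow_natCast, ← Real.rpow_mul hu]
    congr 1
    push_cast
    ring
  intro m z hz
  have hB := IsStrictPosDefKernel.exp_neg_setIntegral (S := Ioi 1) measurableSet_Ioi (by simp)
    (Ioi_subset_Ioi zero_le_one) (fun t ht => hwpos t (one_pos.trans ht)) (hwint 1 one_pos) m z hz
  -- The weight has infinite mass near `0`, so this part is a limit of truncations and only
  -- semidefiniteness survives; strictness comes from `hB`.
  have hA : (Matrix.of fun i j => Real.exp (-∫ t in Ioc 0 1, F |z i - z j| t)).PosSemidef := by
    refine Matrix.PosSemidef.of_tendsto (l := 𝓝[>] (0 : ℝ))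
      (A := fun ε => Matrix.of fun i j => Real.exp (-∫ t in Ioc ε 1, F |z i - z j| t)) ?_ ?_
    · filter_upwards [Ioo_mem_nhdsGT (zero_lt_one' ℝ)] with ε hε
      exact (IsStrictPosDefKernel.exp_neg_setIntegral (S := Ioc ε 1) measurableSet_Ioc
        (by simp [hε.2]) (fun t ht => hε.1.trans ht.1) (fun t ht => hwpos t (hε.1.trans ht.1))
        ((hwint ε hε.1).mono_set Ioc_subset_Ioi_self) m z hz).posSemidef
    · intro i j
      refine (Real.continuous_exp.tendsto _).comp (Tendsto.neg ?_)
      have hc := intervalIntegral.continuousOn_primitive_interval_left (a := 0) (b := 1)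
        (f := F |z i - z j|) (μ := volume) (by
          rw [uIcc_of_le zero_le_one, integrableOn_Icc_iff_integrableOn_Ioc]
          exact (hFint _).mono_set Ioc_subset_Ioi_self) 0 left_mem_uIcc
      rw [uIcc_of_le zero_le_one] at hc
      have hc' := hc.mono_left (nhdsWithin_le_of_mem
        (mem_of_superset (Ioo_mem_nhdsGT (zero_lt_one' ℝ)) Ioo_subset_Icc_self))
      simp only [intervalIntegral.integral_of_le zero_le_one] at hc'
      refine hc'.congr' ?_
      filter_upwards [Ioo_mem_nhdsGT (zero_lt_one' ℝ)] with ε hε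
      rw [intervalIntegral.integral_of_le hε.2.le]
  have := hB.hadamard_posSemidef hA fun i => Real.exp_pos _
  convert this using 1
  ext i j
  simp only [Matrix.of_apply]
  rw [← Real.exp_add, hFeq _ (abs_nonneg _)]
  congr 1
  ring

theorem isStrictPosDefKernel_exp_neg_rpow {α : ℝ} (h0 : 0 < α) (h2 : α ≤ 2) :
    IsStrictPosDefKernel fun u => Real.exp (-(u ^ α)) := by
  rcases h2.eq_or_lt with rfl | h2
  · simpa using isStrictPosDefKernel_gaussian one_pos
  · exact isStrictPosDefKernel_exp_neg_rpow_of_lt_two h0 h2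

/-! ### Matérn correlations, and continuity of both classes. -/

theorem integrableOn_rpow_mul_exp_mul_exp {α : ℝ} (h0 : 0 < α) (u : ℝ) :
    IntegrableOn (fun t => t ^ (α - 1) * Real.exp (-t) * Real.exp (-(1 / (4 * t) * u ^ 2)))
      (Ioi 0) := by
  have hG : IntegrableOn (fun t => t ^ (α - 1) * Real.exp (-t)) (Ioi 0) := by
    simpa only [mul_comm] using Real.GammaIntegral_convergent h0
  refine Integrable.mul_bdd (c := 1) hG (Measurable.aestronglyMeasurable (by fun_prop)) ?_
  filter_upwards [ae_restrict_mem measurableSet_Ioi] with t ht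
  rw [Real.norm_of_nonneg (Real.exp_pos _).le, Real.exp_le_one_iff, neg_nonpos]
  have : 0 < t := ht
  positivity

/-- Under `t = u / 2 * exp v` the exponent `t + u ^ 2 / (4 * t)` becomes `u * cosh v`, which turns
the Gamma-type integral into the Bessel integral. -/
theorem exp_mul_cosh_substitution {α u : ℝ} (hu : 0 < u) (v : ℝ) :
    |u / 2 * Real.exp v| • ((u / 2 * Real.exp v) ^ (α - 1) * Real.exp (-(u / 2 * Real.exp v)) *
      Real.exp (-(1 / (4 * (u / 2 * Real.exp v)) * u ^ 2))) =
    (u / 2) ^ α * (Real.exp (-(u * Real.cosh v)) * Real.exp (α * v)) := by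
  have hp : 0 < u / 2 * Real.exp v := by positivity
  have h1 : (u / 2 * Real.exp v) * (u / 2 * Real.exp v) ^ (α - 1) =
      (u / 2) ^ α * Real.exp (α * v) := by
    rw [Real.rpow_sub_one hp.ne', mul_div_cancel₀ _ hp.ne', Real.mul_rpow (by positivity)
      (Real.exp_pos v).le, ← Real.exp_mul, mul_comm v]
  have h2 : Real.exp (-(u / 2 * Real.exp v)) *
      Real.exp (-(1 / (4 * (u / 2 * Real.exp v)) * u ^ 2)) = Real.exp (-(u * Real.cosh v)) := by
    rw [← Real.exp_add, Real.cosh_eq, Real.exp_neg v]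
    congr 1
    field_simp
    ring
  rw [abs_of_pos hp, smul_eq_mul, ← h2]
  linear_combination (Real.exp (-(u / 2 * Real.exp v)) *
      Real.exp (-(1 / (4 * (u / 2 * Real.exp v)) * u ^ 2))) * h1

theorem besselK_eq_integral {α u : ℝ} (h0 : 0 < α) (hu : 0 < u) :
    2 * (u / 2) ^ α * besselK α u =
      ∫ t in Ioi (0 : ℝ), t ^ (α - 1) * Real.exp (-t) * Real.exp (-(1 / (4 * t) * u ^ 2)) := by
  set g : ℝ → ℝ := fun t => t ^ (α - 1) * Real.exp (-t) * Real.exp (-(1 / (4 * t) * u ^ 2))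
    with hg
  set h : ℝ → ℝ := fun v => Real.exp (-(u * Real.cosh v)) * Real.exp (α * v) with hh
  have hderiv : ∀ v ∈ (univ : Set ℝ),
      HasDerivWithinAt (fun v => u / 2 * Real.exp v) (u / 2 * Real.exp v) univ v :=
    fun v _ => ((Real.hasDerivAt_exp v).const_mul _).hasDerivWithinAt
  have hinj : InjOn (fun v => u / 2 * Real.exp v) univ := fun a _ b _ hab =>
    Real.exp_injective (mul_left_cancel₀ (by positivity) hab)
  have himg : (fun v => u / 2 * Real.exp v) '' univ = Ioi 0 := by
    ext t
    simp only [image_univ, mem_range, mem_Ioi]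
    constructor
    · rintro ⟨v, rfl⟩
      positivity
    · intro ht
      refine ⟨Real.log (t / (u / 2)), ?_⟩
      rw [Real.exp_log (by positivity)]
      field_simp
  have hgi : IntegrableOn g (Ioi 0) := integrableOn_rpow_mul_exp_mul_exp h0 u
  have hi := integrableOn_image_iff_integrableOn_abs_deriv_smul MeasurableSet.univ hderiv hinj g
  have he := integral_image_eq_integral_abs_deriv_smul MeasurableSet.univ hderiv hinj g
  simp only [hg, exp_mul_cosh_substitution hu] at hi he
  rw [himg] at hi he
  have hpos : (u / 2) ^ α ≠ 0 := (Real.rpow_pos_of_pos (by positivity) _).ne'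
  have hint : Integrable h := by
    have := (hi.1 hgi).const_mul ((u / 2) ^ α)⁻¹
    rw [Measure.restrict_univ] at this
    refine this.congr (Eventually.of_forall fun v => ?_)
    simp only [hh]
    rw [inv_mul_cancel_left₀ hpos]
  rw [he, integral_const_mul, Measure.restrict_univ, mul_comm (2 : ℝ), mul_assoc]
  congr 1
  -- Folding the line at `0` pairs `exp (α * v)` with `exp (-(α * v))` and so produces `2 * cosh (α
  -- * v)`.
  have hsplit : ∫ v, h v = (∫ v in Ioi 0, h (-v)) + ∫ v in Ioi 0, h v := by
    rw [integral_comp_neg_Ioi, neg_zero, ← setIntegral_union (Iic_disjoint_Ioi le_rfl)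
      measurableSet_Ioi hint.integrableOn hint.integrableOn, Iic_union_Ioi, Measure.restrict_univ]
  have hneg : Integrable fun v => h (-v) := hint.comp_neg
  change _ = ∫ v, h v
  rw [hsplit, ← integral_add hneg.integrableOn hint.integrableOn, besselK, ← integral_const_mul]
  refine integral_congr_ae (Eventually.of_forall fun v => ?_)
  simp only [hh, Real.cosh_neg, Real.cosh_eq (α * v), mul_neg]
  ring

/-- The Matérn correlation is a scale mixture of Gaussian correlations. -/
theorem corr_matern_eq_integral {α u : ℝ} (h0 : 0 < α) (hu : 0 ≤ u) :
    CorrKind.matern.corr α u = ∫ t in Ioi (0 : ℝ),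
      t ^ (α - 1) * Real.exp (-t) / Real.Gamma α * Real.exp (-(1 / (4 * t) * u ^ 2)) := by
  have hG : 0 < Real.Gamma α := Real.Gamma_pos_of_pos h0
  have hdiv : ∫ t in Ioi (0 : ℝ),
      t ^ (α - 1) * Real.exp (-t) / Real.Gamma α * Real.exp (-(1 / (4 * t) * u ^ 2)) =
      (∫ t in Ioi (0 : ℝ), t ^ (α - 1) * Real.exp (-t) * Real.exp (-(1 / (4 * t) * u ^ 2))) /
        Real.Gamma α := by
    rw [← integral_div]
    exact integral_congr_ae (Eventually.of_forall fun t => by ring)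
  rw [hdiv, CorrKind.corr]
  rcases hu.eq_or_lt with rfl | hu
  · simp only [if_true]
    rw [eq_comm, div_eq_one_iff_eq hG.ne', Real.Gamma_eq_integral h0]
    exact integral_congr_ae (Eventually.of_forall fun t => by simp [mul_comm])
  · rw [if_neg hu.ne', ← besselK_eq_integral h0 hu, Real.div_rpow hu.le zero_le_two,
      Real.rpow_sub_one two_ne_zero]
    have : (2 : ℝ) ^ α ≠ 0 := (Real.rpow_pos_of_pos two_pos _).ne'
    field_simp

theorem isStrictPosDefKernel_corr {k : CorrKind} {α : ℝ} (h : k.Admissible α) :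
    IsStrictPosDefKernel (k.corr α) := by
  cases k with
  | powerExp => exact isStrictPosDefKernel_exp_neg_rpow h.1 h.2
  | matern =>
    have h0 : 0 < α := h
    intro m z hz
    have := IsStrictPosDefKernel.setIntegral_gaussian (S := Ioi 0) measurableSet_Ioi (by simp)
      (w := fun t => t ^ (α - 1) * Real.exp (-t) / Real.Gamma α) (σ := fun t => 1 / (4 * t))
      (fun t ht => div_pos (mul_pos (Real.rpow_pos_of_pos ht _) (Real.exp_pos _))
        (Real.Gamma_pos_of_pos h0))
      (fun t ht => by have : 0 < t := ht; positivity)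
      (fun u _ => ((integrableOn_rpow_mul_exp_mul_exp h0 u).div_const (Real.Gamma α)).congr
        (Eventually.of_forall fun t => by ring)) m z hz
    convert this using 1
    ext i j
    simp only [Matrix.of_apply]
    exact corr_matern_eq_integral h0 (abs_nonneg _)

theorem continuousOn_corr {k : CorrKind} {α : ℝ} (h : k.Admissible α) :
    ContinuousOn (k.corr α) (Ici 0) := by
  cases k with
  | powerExp =>
    have h0 : 0 < α := h.1
    exact (Real.continuous_exp.comp (Real.continuous_rpow_const h0.le).neg).continuousOn
  | matern =>
    have h0 : 0 < α := h
    refine ContinuousOn.congr (Continuous.continuousOn ?_) fun u hu =>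
      corr_matern_eq_integral h0 hu
    -- The mixture formula covers `u = 0` as well, so continuity there needs no asymptotics of
    -- `besselK`: the Gaussian factors are at most `1`.
    refine continuous_of_dominated
      (bound := fun t => t ^ (α - 1) * Real.exp (-t) / Real.Gamma α) ?_ ?_ ?_ ?_
    · intro u
      exact Measurable.aestronglyMeasurable (by fun_prop)
    · intro u
      filter_upwards [ae_restrict_mem measurableSet_Ioi] with t ht
      have ht' : 0 < t := ht
      have hw : 0 ≤ t ^ (α - 1) * Real.exp (-t) / Real.Gamma α :=
        div_nonneg (by positivity) (Real.Gamma_pos_of_pos h0).le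
      rw [Real.norm_of_nonneg (mul_nonneg hw (Real.exp_pos _).le)]
      refine mul_le_of_le_one_right hw (Real.exp_le_one_iff.2 (neg_nonpos.2 (by positivity)))
    · refine Integrable.div_const ?_ _
      have := Real.GammaIntegral_convergent h0
      simp only [mul_comm] at this
      exact this
    · exact Eventually.of_forall fun t => by fun_prop

/-! ### Positive definiteness of the correlation matrix on the closed orthant. -/

/-- Schur products are monotone on the semidefinite cone, by telescoping: `A * A' - B * B' = (A - B)
* A' + B * (A' - B')` entrywise. -/
theorem Matrix.posSemidef_prod_sub_prod {m ι : Type*} [Fintype m] {A B : ι → Matrix m m ℝ}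
    (s : Finset ι) (hB : ∀ l ∈ s, (B l).PosSemidef) (hAB : ∀ l ∈ s, (A l - B l).PosSemidef) :
    (Matrix.of fun i j => ∏ l ∈ s, B l i j).PosSemidef ∧
      (Matrix.of fun i j => ∏ l ∈ s, A l i j - ∏ l ∈ s, B l i j).PosSemidef := by
  classical
  induction s using Finset.induction_on with
  | empty =>
    refine ⟨by simpa using posSemidef_of_one, ?_⟩
    simp only [Finset.prod_empty, sub_self]
    exact PosSemidef.zero
  | insert l s hl ih =>
    obtain ⟨ih1, ih2⟩ := ih (fun k hk => hB k (Finset.mem_insert_of_mem hk))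
      fun k hk => hAB k (Finset.mem_insert_of_mem hk)
    have hBl := hB l (Finset.mem_insert_self l s)
    have hABl := hAB l (Finset.mem_insert_self l s)
    simp only [Finset.prod_insert hl]
    refine ⟨hBl.of_mul ih1, ?_⟩
    have := (hABl.of_mul (ih1.add ih2)).add (hBl.of_mul ih2)
    convert this using 1
    ext i j
    simp only [of_apply, add_apply, sub_apply]
    ring

/-- At points that need not be distinct, a strictly positive definite kernel dominates a multiple
of the equality relation. -/
theorem IsStrictPosDefKernel.exists_posSemidef_sub {f : ℝ → ℝ} (hf : IsStrictPosDefKernel f)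
    {n : ℕ} (x : Fin n → ℝ) :
    ∃ c : ℝ, 0 < c ∧ (Matrix.of fun i j => c * if x i = x j then 1 else 0).PosSemidef ∧
      ((Matrix.of fun i j => f |x i - x j|) -
        Matrix.of fun i j => c * if x i = x j then 1 else 0).PosSemidef := by
  classical
  -- Strictness is applied to the distinct values of `x`. Pulling back along `r` turns the identity
  -- matrix into the indicator of equal values.
  let e := Fintype.equivFin (range x)
  let z : Fin (Fintype.card (range x)) → ℝ := fun k => (e.symm k : ℝ)
  have hz : Function.Injective z := Subtype.val_injective.comp e.symm.injective
  let r : Fin n → Fin (Fintype.card (range x)) := fun i => e ⟨x i, mem_range_self i⟩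
  have hzr : ∀ i, z (r i) = x i := fun i => by simp [z, r]
  have hr : ∀ i j, r i = r j ↔ x i = x j := fun i j => by
    rw [← hz.eq_iff, hzr, hzr]
  obtain ⟨c, hc, h⟩ := (hf _ z hz).exists_posSemidef_sub
  refine ⟨c, hc, ?_, ?_⟩
  · have := (Matrix.PosSemidef.one (n := Fin (Fintype.card (range x))) (R := ℝ)).smul hc.le
    convert this.submatrix r using 1
    ext i j
    simp [Matrix.one_apply, hr]
  · convert h.submatrix r using 1
    ext i j
    simp [Matrix.one_apply, hr, hzr]

/-- The correlation matrix is positive definite as soon as the coordinates with positive inverse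
range separate the design points. -/
theorem posDef_corrMatrix {n p : ℕ} {kind : Fin p → CorrKind} {α : Fin p → ℝ}
    (hα : ∀ l, (kind l).Admissible (α l)) {x : Fin n → Fin p → ℝ} {β : Fin p → ℝ}
    (hβ : ∀ l, 0 ≤ β l) (hx : ∀ i j, i ≠ j → ∃ l, 0 < β l ∧ x i l ≠ x j l) :
    (corrMatrix kind α x β).PosDef := by
  classical
  have key : ∀ l, ∃ c : ℝ, 0 < c ∧
      (Matrix.of fun i j => c * if x i l * β l = x j l * β l then 1 else 0).PosSemidef ∧
      ((Matrix.of fun i j => (kind l).corr (α l) (|x i l - x j l| * β l)) -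
        Matrix.of fun i j => c * if x i l * β l = x j l * β l then 1 else 0).PosSemidef := by
    intro l
    have := (isStrictPosDefKernel_corr (hα l)).exists_posSemidef_sub fun i => x i l * β l
    simpa only [← sub_mul, abs_mul, abs_of_nonneg (hβ l)] using this
  choose c hc hB hAB using key
  have h := (Matrix.posSemidef_prod_sub_prod Finset.univ (fun l _ => hB l) fun l _ => hAB l).2
  have hpos : 0 < ∏ l, c l := Finset.prod_pos fun l _ => hc l
  -- The product of the lower bounds is this diagonal matrix: off the diagonal some coordinate with
  -- `0 < β l` separates the two points and kills the product.
  have h2 : (Matrix.diagonal fun _ : Fin n => ∏ l, c l).PosDef :=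
    Matrix.posDef_diagonal_iff.2 fun _ => hpos
  have := Matrix.PosDef.posSemidef_add h h2
  convert this using 1
  ext i j
  simp only [corrMatrix, Matrix.of_apply, Matrix.add_apply]
  by_cases hij : i = j
  · subst hij
    simp
  · obtain ⟨l, hl, hne⟩ := hx i j hij
    have : ∏ l, (c l * if x i l * β l = x j l * β l then (1 : ℝ) else 0) = 0 := by
      refine Finset.prod_eq_zero (Finset.mem_univ l) ?_
      rw [if_neg fun h => hne (mul_right_cancel₀ hl.ne' h), mul_zero]
    rw [this, Matrix.diagonal_apply_ne _ hij]
    ring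

theorem continuousOn_corrMatrix {n p : ℕ} {kind : Fin p → CorrKind} {α : Fin p → ℝ}
    (hα : ∀ l, (kind l).Admissible (α l)) (x : Fin n → Fin p → ℝ) :
    ContinuousOn (corrMatrix kind α x) {β : Fin p → ℝ | ∀ l, 0 ≤ β l} := by
  refine continuousOn_pi.2 fun i => continuousOn_pi.2 fun j => ?_
  simp only [corrMatrix, Matrix.of_apply]
  refine continuousOn_finsetProd _ fun l _ => ?_
  exact (continuousOn_corr (hα l)).comp (by fun_prop) fun β hβ => mul_nonneg (abs_nonneg _) (hβ l)

/-! ### The integrated likelihood as a continuous function of the correlation matrix. -/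

theorem lintegral_rpow_mul_exp_neg_div {a N : ℝ} (ha : 0 < a) (hN : 0 < N) :
    ∫⁻ s in Ioi (0 : ℝ), ENNReal.ofReal (s ^ (-a - 1) * Real.exp (-(N / s))) =
      ENNReal.ofReal (N ^ (-a) * Real.Gamma a) := by
  have h1 := integral_comp_rpow_Ioi (fun t : ℝ => t ^ (a - 1) * Real.exp (-(N * t)))
    (p := -1) (by norm_num)
  rw [Real.integral_rpow_mul_exp_neg_mul_Ioi ha hN, one_div, Real.inv_rpow hN.le,
    ← Real.rpow_neg hN.le] at h1
  have h2 : ∫ s in Ioi (0 : ℝ), s ^ (-a - 1) * Real.exp (-(N / s)) = N ^ (-a) * Real.Gamma a := by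
    rw [← h1]
    refine setIntegral_congr_fun measurableSet_Ioi fun s hs => ?_
    have hs' : 0 < s := hs
    simp only [abs_neg, abs_one, one_mul, smul_eq_mul, ← Real.rpow_mul hs'.le]
    rw [← mul_assoc, ← Real.rpow_add hs', Real.rpow_neg_one, div_eq_mul_inv]
    congr 2
    ring
  have hpos : 0 < N ^ (-a) * Real.Gamma a :=
    mul_pos (Real.rpow_pos_of_pos hN _) (Real.Gamma_pos_of_pos ha)
  rw [← h2, ofReal_integral_eq_lintegral_ofReal]
  · exact not_imp_comm.1 integral_undef (by rw [h2]; exact hpos.ne')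
  · filter_upwards [ae_restrict_mem measurableSet_Ioi] with s hs
    have : 0 < s := hs
    positivity

/-- If `H` is injective and `y` is not in its range, the residual norm controls the parameter. -/
theorem exists_le_residual {n q : ℕ} {H : Matrix (Fin n) (Fin q) ℝ} {y : Fin n → ℝ}
    (hH : H.rank = q) (hy : y ∉ LinearMap.range H.mulVecLin) :
    q < n ∧ ∃ κ > 0, ∀ θ : Fin q → ℝ,
      κ * (1 + ‖θ‖ ^ 2) ≤ (y - H.mulVec θ) ⬝ᵥ (y - H.mulVec θ) := by
  have hker : LinearMap.ker H.mulVecLin = ⊥ := by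
    have h := H.mulVecLin.finrank_range_add_finrank_ker
    rw [Module.finrank_fin_fun, ← Matrix.rank, hH] at h
    exact Submodule.finrank_eq_zero.1 (by omega)
  -- Adjoining `y` as an extra column keeps the map injective. Counting dimensions gives `q < n`;
  -- the antilipschitz bound at `r = 1` gives `κ`.
  let T : (ℝ × (Fin q → ℝ)) →ₗ[ℝ] (Fin n → ℝ) :=
    (LinearMap.toSpanSingleton ℝ (Fin n → ℝ) y).coprod (-H.mulVecLin)
  have hTapp : ∀ r θ, T (r, θ) = r • y - H.mulVec θ := fun r θ => by
    simp [T, sub_eq_add_neg]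
  have hT : LinearMap.ker T = ⊥ := by
    rw [LinearMap.ker_eq_bot']
    rintro ⟨r, θ⟩ h
    rw [hTapp, sub_eq_zero] at h
    have hr : r = 0 := by
      by_contra hr
      refine hy ⟨r⁻¹ • θ, ?_⟩
      rw [Matrix.mulVecLin_apply, Matrix.mulVec_smul, ← h, smul_smul, inv_mul_cancel₀ hr, one_smul]
    subst hr
    rw [zero_smul] at h
    have : θ = 0 := (LinearMap.ker_eq_bot'.1 hker) θ (by simpa using h.symm)
    rw [this]
    rfl
  constructor
  · have := LinearMap.finrank_le_finrank_of_injective (LinearMap.ker_eq_bot.1 hT)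
    simp only [Module.finrank_prod, Module.finrank_self, Module.finrank_fin_fun] at this
    omega
  · obtain ⟨K, hK, hanti⟩ := T.exists_antilipschitzWith hT
    have hK' : (0 : ℝ) < K := hK
    refine ⟨(2 * (K : ℝ) ^ 2)⁻¹, by positivity, fun θ => ?_⟩
    set v := y - H.mulVec θ with hv
    have hb : ‖((1 : ℝ), θ)‖ ≤ K * ‖v‖ := by
      have := hanti.le_mul_dist (1, θ) 0
      rwa [dist_zero_right, map_zero, dist_zero_right, hTapp, one_smul] at this
    rw [Prod.norm_def, max_le_iff, norm_one] at hb
    have hvv : ‖v‖ ^ 2 ≤ v ⬝ᵥ v := by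
      have hnn : 0 ≤ v ⬝ᵥ v := Finset.sum_nonneg fun i _ => mul_self_nonneg _
      rw [← Real.le_sqrt (norm_nonneg _) hnn, pi_norm_le_iff_of_nonneg (Real.sqrt_nonneg _)]
      intro i
      rw [Real.norm_eq_abs]
      refine Real.abs_le_sqrt ?_
      rw [sq]
      exact Finset.single_le_sum (f := fun i => v i * v i) (fun _ _ => mul_self_nonneg _)
        (Finset.mem_univ i)
    have h1 : 1 + ‖θ‖ ^ 2 ≤ 2 * (K : ℝ) ^ 2 * ‖v‖ ^ 2 := by
      have e1 : (1 : ℝ) ^ 2 ≤ (K * ‖v‖) ^ 2 := pow_le_pow_left₀ zero_le_one hb.1 2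
      have e2 : ‖θ‖ ^ 2 ≤ (K * ‖v‖) ^ 2 := pow_le_pow_left₀ (norm_nonneg _) hb.2 2
      rw [mul_pow] at e1 e2
      linarith
    rw [inv_mul_le_iff₀ (by positivity)]
    exact h1.trans (mul_le_mul_of_nonneg_left hvv (by positivity))

/-- The multivariate normal likelihood of the residual `v` times the prior of the variance `s`,
as a function of the correlation matrix. -/
noncomputable def scaledDensity {n : ℕ} (R : Matrix (Fin n) (Fin n) ℝ) (v : Fin n → ℝ) (s : ℝ) :
    ℝ :=
  (Real.sqrt ((2 * Real.pi) ^ n * (s ^ n * R.det)))⁻¹ *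
    Real.exp (-(s⁻¹ * (v ⬝ᵥ R⁻¹.mulVec v)) / 2) * s⁻¹

theorem mvnDensity_smul_mul_inv {n : ℕ} {R : Matrix (Fin n) (Fin n) ℝ} (hR : 0 < R.det)
    (μ y : Fin n → ℝ) {s : ℝ} (hs : 0 < s) :
    mvnDensity μ (s • R) y * s⁻¹ = scaledDensity R (y - μ) s := by
  have hinv : (s • R)⁻¹ = s⁻¹ • R⁻¹ := by
    have := invertibleOfNonzero hs.ne'
    rw [Matrix.inv_smul R s (isUnit_iff_ne_zero.2 hR.ne'), invOf_eq_inv]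
  rw [mvnDensity, scaledDensity, hinv, Matrix.det_smul, Fintype.card_fin, Matrix.smul_mulVec,
    dotProduct_smul, smul_eq_mul]

theorem scaledDensity_pos {n : ℕ} {R : Matrix (Fin n) (Fin n) ℝ} (hR : 0 < R.det)
    (v : Fin n → ℝ) {s : ℝ} (hs : 0 < s) : 0 < scaledDensity R v s := by
  have := Real.pi_pos
  unfold scaledDensity
  positivity

theorem measurable_scaledDensity {n q : ℕ} (R : Matrix (Fin n) (Fin n) ℝ)
    (H : Matrix (Fin n) (Fin q) ℝ) (y : Fin n → ℝ) :
    Measurable fun z : (Fin q → ℝ) × ℝ => scaledDensity R (y - H.mulVec z.1) z.2 := by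
  have hv : Continuous fun θ : Fin q → ℝ => y - H.mulVec θ :=
    continuous_const.sub (continuous_const.matrix_mulVec continuous_id)
  have hq : Measurable fun z : (Fin q → ℝ) × ℝ =>
      (y - H.mulVec z.1) ⬝ᵥ R⁻¹.mulVec (y - H.mulVec z.1) :=
    ((hv.dotProduct (continuous_const.matrix_mulVec hv)).measurable).comp measurable_fst
  unfold scaledDensity
  fun_prop

theorem Matrix.continuousAt_inv_of_det_ne_zero {m : Type*} [Fintype m] [DecidableEq m]
    {R : Matrix m m ℝ} (hR : R.det ≠ 0) : ContinuousAt (fun M : Matrix m m ℝ => M⁻¹) R := by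
  refine continuousAt_matrix_inv R ?_
  rw [Ring.inverse_eq_inv']
  exact continuousAt_inv₀ hR

theorem continuousAt_scaledDensity {n : ℕ} {R : Matrix (Fin n) (Fin n) ℝ} (hR : 0 < R.det)
    (v : Fin n → ℝ) {s : ℝ} (hs : 0 < s) :
    ContinuousAt (fun M : Matrix (Fin n) (Fin n) ℝ => scaledDensity M v s) R := by
  have hdet : ContinuousAt (fun M : Matrix (Fin n) (Fin n) ℝ => M.det) R :=
    continuous_id.matrix_det.continuousAt
  have hq : ContinuousAt (fun M : Matrix (Fin n) (Fin n) ℝ => v ⬝ᵥ M⁻¹.mulVec v) R :=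
    (show Continuous fun M : Matrix (Fin n) (Fin n) ℝ => v ⬝ᵥ M.mulVec v from
      continuous_const.dotProduct (continuous_id.matrix_mulVec continuous_const)).continuousAt.comp
      (Matrix.continuousAt_inv_of_det_ne_zero hR.ne')
  have hsq : √((2 * Real.pi) ^ n * (s ^ n * R.det)) ≠ 0 := by
    have := Real.pi_pos
    positivity
  unfold scaledDensity
  refine ContinuousAt.mul (ContinuousAt.mul (ContinuousAt.inv₀ ?_ hsq) ?_) continuousAt_const
  · fun_prop
  · fun_prop

/-- The bound sees `R` only through `d` and `N`, so it serves a whole neighbourhood of matrices; in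
`s` it is an inverse-gamma kernel. -/
theorem scaledDensity_le {n : ℕ} {R : Matrix (Fin n) (Fin n) ℝ} {v : Fin n → ℝ} {d N s : ℝ}
    (hd : 0 < d) (hdR : d ≤ R.det) (hN : N ≤ v ⬝ᵥ R⁻¹.mulVec v) (hs : 0 < s) :
    scaledDensity R v s ≤ (√((2 * Real.pi) ^ n * d))⁻¹ *
      (s ^ (-(n / 2 : ℝ) - 1) * Real.exp (-(N / 2 / s))) := by
  have hpi := Real.pi_pos
  have hsn : s ^ (-(n / 2 : ℝ) - 1) = (√(s ^ n))⁻¹ * s⁻¹ := by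
    rw [Real.rpow_sub_one hs.ne', Real.rpow_neg hs.le, Real.sqrt_eq_rpow, ← Real.rpow_natCast,
      ← Real.rpow_mul hs.le, div_eq_mul_inv, div_eq_mul_inv, one_div]
  have hsqrt : √((2 * Real.pi) ^ n * d) * √(s ^ n) ≤
      √((2 * Real.pi) ^ n * (s ^ n * R.det)) := by
    rw [← Real.sqrt_mul (by positivity)]
    refine Real.sqrt_le_sqrt ?_
    rw [mul_assoc, mul_comm d]
    gcongr
  have h0 : 0 < √((2 * Real.pi) ^ n * d) * √(s ^ n) := by positivity
  calc scaledDensity R v s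
      ≤ (√((2 * Real.pi) ^ n * d) * √(s ^ n))⁻¹ * Real.exp (-(N / 2 / s)) * s⁻¹ := by
        unfold scaledDensity
        have hexp : -(s⁻¹ * (v ⬝ᵥ R⁻¹.mulVec v)) / 2 ≤ -(N / 2 / s) := by
          have := mul_le_mul_of_nonneg_left hN (inv_pos.2 hs).le
          have e : N / 2 / s = s⁻¹ * N / 2 := by ring
          rw [e]
          linarith
        gcongr
    _ = _ := by rw [hsn, mul_inv]; ring

/-- The marginal likelihood as a function of the correlation matrix. -/
noncomputable def matrixLikelihood {n q : ℕ} (H : Matrix (Fin n) (Fin q) ℝ) (y : Fin n → ℝ)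
    (R : Matrix (Fin n) (Fin n) ℝ) : ℝ≥0∞ :=
  ∫⁻ θ : Fin q → ℝ, ∫⁻ s in Ioi (0 : ℝ), ENNReal.ofReal (scaledDensity R (y - H.mulVec θ) s)

theorem marginalLikelihood_eq_matrixLikelihood {n p q : ℕ} {kind : Fin p → CorrKind}
    {α : Fin p → ℝ} {x : Fin n → Fin p → ℝ} (H : Matrix (Fin n) (Fin q) ℝ) (y : Fin n → ℝ)
    {β : Fin p → ℝ} (hR : 0 < (corrMatrix kind α x β).det) :
    marginalLikelihood kind α x H y β = matrixLikelihood H y (corrMatrix kind α x β) :=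
  lintegral_congr fun θ => setLIntegral_congr_fun measurableSet_Ioi fun s hs => by
    rw [mvnDensity_smul_mul_inv hR _ _ hs]

theorem matrixLikelihood_pos {n q : ℕ} (H : Matrix (Fin n) (Fin q) ℝ) (y : Fin n → ℝ)
    {R : Matrix (Fin n) (Fin n) ℝ} (hR : 0 < R.det) : 0 < matrixLikelihood H y R := by
  have hm := measurable_scaledDensity R H y
  have hm1 : ∀ θ, Measurable fun s => ENNReal.ofReal (scaledDensity R (y - H.mulVec θ) s) :=
    fun θ => (hm.comp measurable_prodMk_left).ennreal_ofReal
  have hm2 : Measurable fun θ => ∫⁻ s in Ioi (0 : ℝ),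
      ENNReal.ofReal (scaledDensity R (y - H.mulVec θ) s) :=
    Measurable.lintegral_prod_right' (f := fun z : (Fin q → ℝ) × ℝ =>
      ENNReal.ofReal (scaledDensity R (y - H.mulVec z.1) z.2)) hm.ennreal_ofReal
  have hin : ∀ θ, 0 < ∫⁻ s in Ioi (0 : ℝ),
      ENNReal.ofReal (scaledDensity R (y - H.mulVec θ) s) := by
    intro θ
    rw [setLIntegral_pos_iff (hm1 θ), inter_eq_right.2 fun s (hs : s ∈ Ioi 0) =>
      Function.mem_support.2 (ENNReal.ofReal_pos.2 (scaledDensity_pos hR _ hs)).ne']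
    simp
  rw [matrixLikelihood, lintegral_pos_iff_support hm2,
    Function.support_eq_univ fun θ => (hin θ).ne']
  exact pos_iff_ne_zero.2 (NeZero.ne _)

theorem matrixLikelihood_lt_top_and_tendsto {n q : ℕ} {H : Matrix (Fin n) (Fin q) ℝ}
    {y : Fin n → ℝ} (hH : H.rank = q) (hy : y ∉ LinearMap.range H.mulVecLin)
    {R : Matrix (Fin n) (Fin n) ℝ} (hR : R.PosDef) {ι : Type*} {l : Filter ι}
    [l.IsCountablyGenerated] {A : ι → Matrix (Fin n) (Fin n) ℝ} (hA : Tendsto A l (𝓝 R)) :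
    matrixLikelihood H y R < ∞ ∧
      Tendsto (fun k => matrixLikelihood H y (A k)) l (𝓝 (matrixLikelihood H y R)) := by
  obtain ⟨hqn, κ, hκ, hres⟩ := exists_le_residual hH hy
  have hdet : 0 < R.det := hR.det_pos
  obtain ⟨c, hc, hcoer⟩ := hR.inv.exists_eventually_le
  have hcoer' := (Matrix.continuousAt_inv_of_det_ne_zero hdet.ne').eventually hcoer
  have hdet' : ∀ᶠ M in 𝓝 R, R.det / 2 ≤ M.det :=
    (continuous_id.matrix_det.tendsto R).eventually (le_mem_nhds (half_lt_self hdet))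
  -- Here `c` is the coercivity constant of the inverses near `R` and `κ` that of the residuals.
  set N : (Fin q → ℝ) → ℝ := fun θ => c * (κ * (1 + ‖θ‖ ^ 2)) with hN
  set D := (√((2 * Real.pi) ^ n * (R.det / 2)))⁻¹ with hD
  have hD0 : 0 ≤ D := by positivity
  set g : (Fin q → ℝ) → ℝ → ℝ≥0∞ := fun θ s =>
    ENNReal.ofReal (D * (s ^ (-(n / 2 : ℝ) - 1) * Real.exp (-(N θ / 2 / s)))) with hg
  have hbound : ∀ᶠ M in 𝓝 R, ∀ θ, ∀ s, 0 < s →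
      ENNReal.ofReal (scaledDensity M (y - H.mulVec θ) s) ≤ g θ s := by
    filter_upwards [hcoer', hdet'] with M h1 h2 θ s hs
    exact ENNReal.ofReal_le_ofReal (scaledDensity_le (half_pos hdet) h2
      ((mul_le_mul_of_nonneg_left (hres θ) hc.le).trans (h1 _)) hs)
  have hn0 : (0 : ℝ) < n / 2 := by
    have : (0 : ℝ) < n := by exact_mod_cast (Nat.zero_le q).trans_lt hqn
    linarith
  have hgint : ∀ θ, ∫⁻ s in Ioi (0 : ℝ), g θ s = ENNReal.ofReal
      (D * (c * κ / 2) ^ (-(n / 2 : ℝ)) * Real.Gamma (n / 2) *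
        (1 + ‖θ‖ ^ 2) ^ (-(n : ℝ) / 2)) := by
    intro θ
    have hNpos : 0 < N θ / 2 := by positivity
    simp only [hg, ENNReal.ofReal_mul hD0]
    rw [lintegral_const_mul' _ _ ENNReal.ofReal_ne_top,
      lintegral_rpow_mul_exp_neg_div hn0 hNpos, ← ENNReal.ofReal_mul hD0]
    congr 1
    rw [show N θ / 2 = (c * κ / 2) * (1 + ‖θ‖ ^ 2) by simp only [hN]; ring,
      Real.mul_rpow (by positivity) (by positivity), neg_div]
    ring
  have hgfin : ∫⁻ θ, ∫⁻ s in Ioi (0 : ℝ), g θ s ≠ ∞ := by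
    simp only [hgint]
    -- Integrating out `s` leaves decay of order `‖θ‖ ^ (-n)`, integrable in dimension `q` because
    -- `q < n`.
    have hi : Integrable fun θ : Fin q → ℝ => (1 + ‖θ‖ ^ 2) ^ (-(n : ℝ) / 2) :=
      integrable_rpow_neg_one_add_norm_sq (by simpa using hqn)
    exact (hi.const_mul _).lintegral_lt_top.ne
  have hmeas := fun M => measurable_scaledDensity M H y
  constructor
  · refine lt_of_le_of_lt (lintegral_mono fun θ => ?_) hgfin.lt_top
    exact setLIntegral_mono' measurableSet_Ioi fun s hs => hbound.self_of_nhds θ s hs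
  · have hev := hA.eventually hbound
    refine tendsto_lintegral_filter_of_dominated_convergence
      (fun θ => ∫⁻ s in Ioi (0 : ℝ), g θ s) ?_ ?_ hgfin ?_
    · exact Eventually.of_forall fun k => Measurable.lintegral_prod_right'
        (f := fun z : (Fin q → ℝ) × ℝ =>
          ENNReal.ofReal (scaledDensity (A k) (y - H.mulVec z.1) z.2)) (hmeas _).ennreal_ofReal
    · filter_upwards [hev] with k hk
      exact Eventually.of_forall fun θ =>
        setLIntegral_mono' measurableSet_Ioi fun s hs => hk θ s hs
    · refine Eventually.of_forall fun θ => ?_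
      refine tendsto_lintegral_filter_of_dominated_convergence (g θ) ?_ ?_ ?_ ?_
      · exact Eventually.of_forall fun k =>
          ((hmeas (A k)).comp measurable_prodMk_left).ennreal_ofReal
      · filter_upwards [hev] with k hk
        filter_upwards [ae_restrict_mem measurableSet_Ioi] with s hs using hk θ s hs
      · rw [hgint]
        exact ENNReal.ofReal_ne_top
      · filter_upwards [ae_restrict_mem measurableSet_Ioi] with s hs
        exact (ENNReal.continuous_ofReal.tendsto _).comp
          ((continuousAt_scaledDensity hdet _ hs).tendsto.comp hA)

/-! ### The prior, the normalizing mass and the conclusion. -/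

theorem continuous_jrPrior {p : ℕ} {a : ℝ} (ha : 0 < a) (b : ℝ) (C : Fin p → ℝ) :
    Continuous (jrPrior a b C) := by
  have hs : Continuous fun β : Fin p → ℝ => ∑ l, C l * β l := by fun_prop
  unfold jrPrior
  exact (continuous_const.mul (hs.rpow_const fun _ => Or.inr ha.le)).mul
    (Real.continuous_exp.comp (continuous_const.mul hs))

theorem jrPrior_pos {p : ℕ} {a b : ℝ} {C β : Fin p → ℝ} (ha : 0 < a) (hb : 0 < b)
    (hC : ∀ l, 0 < C l) (hβ : ∀ l, 0 ≤ β l) (hβ' : ∃ l, 0 < β l) : 0 < jrPrior a b C β := by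
  obtain ⟨l, hl⟩ := hβ'
  have hsum : 0 < ∑ l, C l * β l :=
    Finset.sum_pos' (fun k _ => mul_nonneg (hC k).le (hβ k))
      ⟨l, Finset.mem_univ l, mul_pos (hC l) hl⟩
  have hprod : 0 < ∏ l, C l := Finset.prod_pos fun l _ => hC l
  have hG : 0 < Real.Gamma (a + p) := Real.Gamma_pos_of_pos (by positivity)
  unfold jrPrior
  positivity

/-- A function with a positive limit at a point of the closed orthant, taken along the closed
orthant, has positive integral over the open orthant. -/
theorem setLIntegral_orthant_pos {p : ℕ} {u : (Fin p → ℝ) → ℝ≥0∞} {β₀ : Fin p → ℝ} {L : ℝ≥0∞}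
    (hβ₀ : ∀ l, 0 ≤ β₀ l) (hL : 0 < L)
    (hu : Tendsto u (𝓝[{β : Fin p → ℝ | ∀ l, 0 ≤ β l}] β₀) (𝓝 L)) :
    0 < ∫⁻ β in {β : Fin p → ℝ | ∀ l, 0 < β l}, u β := by
  obtain ⟨c, hc0, hcL⟩ := exists_between hL
  obtain ⟨U, hU, hβU, hUc⟩ := mem_nhdsWithin.1 (hu.eventually (lt_mem_nhds hcL))
  set P := {β : Fin p → ℝ | ∀ l, 0 < β l} with hP
  have hPo : IsOpen P := by
    simp only [hP, ofPred_forall]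
    exact isOpen_iInter_of_finite fun l => isOpen_lt continuous_const (continuous_apply l)
  -- Moving from `β₀` slightly along the all-ones direction enters the open orthant.
  have hne : (U ∩ P).Nonempty := by
    have ht : Tendsto (fun t : ℝ => fun l => β₀ l + t) (𝓝[>] 0) (𝓝 β₀) := by
      have : Continuous fun t : ℝ => fun l => β₀ l + t := by fun_prop
      have h := this.tendsto 0
      simp only [add_zero] at h
      exact h.mono_left nhdsWithin_le_nhds
    obtain ⟨t, htU, ht0⟩ := ((ht.eventually (hU.mem_nhds hβU)).and self_mem_nhdsWithin).exists
    exact ⟨_, htU, fun l => add_pos_of_nonneg_of_pos (hβ₀ l) ht0⟩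
  have hVo : IsOpen (U ∩ P) := hU.inter hPo
  calc 0 < c * volume (U ∩ P) := ENNReal.mul_pos hc0.ne' (hVo.measure_pos _ hne).ne'
    _ = ∫⁻ _ in U ∩ P, c := (setLIntegral_const _ _).symm
    _ ≤ ∫⁻ β in U ∩ P, u β := setLIntegral_mono' hVo.measurableSet fun β hβ =>
        le_of_lt (hUc ⟨hβ.1, fun l => (hβ.2 l).le⟩)
    _ ≤ ∫⁻ β in P, u β := lintegral_mono_set inter_subset_right

theorem mainTheorem3 {n p q : ℕ}
    (kind : Fin p → CorrKind) (α : Fin p → ℝ) (hα : ∀ l, (kind l).Admissible (α l))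
    (x : Fin n → Fin p → ℝ) (H : Matrix (Fin n) (Fin q) ℝ) (y : Fin n → ℝ)
    (hH : H.rank = q)
    (h1 : (fun _ => 1 : Fin n → ℝ) ∉ LinearMap.range H.mulVecLin)
    (hy : y ∉ LinearMap.range H.mulVecLin)
    (a b : ℝ) (C : Fin p → ℝ) (ha : 0 < a) (hb : 0 < b) (hC : ∀ l, 0 < C l)
    (E : Finset (Fin p)) (hE : E.Nonempty) (hE' : E ≠ Finset.univ)
    (hx : ∀ i j, i ≠ j → ∃ l, l ∉ E ∧ x i l ≠ x j l)
    (β₀ : Fin p → ℝ) (hβE : ∀ l, l ∈ E → β₀ l = 0) (hβ : ∀ l, l ∉ E → 0 < β₀ l) :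
    (0 < unnormalizedPosterior kind α x H y a b C β₀ ∧
      unnormalizedPosterior kind α x H y a b C β₀ < ∞ ∧
      Tendsto (unnormalizedPosterior kind α x H y a b C)
        (𝓝[{β : Fin p → ℝ | ∀ l, 0 ≤ β l}] β₀)
        (𝓝 (unnormalizedPosterior kind α x H y a b C β₀))) ∧
    (posteriorMass kind α x H y a b C ≠ ∞ →
      0 < marginalPosterior kind α x H y a b C β₀ ∧
      marginalPosterior kind α x H y a b C β₀ < ∞ ∧
      Tendsto (marginalPosterior kind α x H y a b C)
        (𝓝[{β : Fin p → ℝ | ∀ l, 0 ≤ β l}] β₀)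
        (𝓝 (marginalPosterior kind α x H y a b C β₀))) := by
  have hβ0 : ∀ l, 0 ≤ β₀ l := fun l => by
    by_cases hl : l ∈ E
    · exact (hβE l hl).ge
    · exact (hβ l hl).le
  have hβpos : ∃ l, 0 < β₀ l := by
    obtain ⟨l, hl⟩ := not_forall.1 fun h => hE' (Finset.eq_univ_iff_forall.2 h)
    exact ⟨l, hβ l hl⟩
  have hR : (corrMatrix kind α x β₀).PosDef := posDef_corrMatrix hα hβ0 fun i j hij => by
    obtain ⟨l, hl, hne⟩ := hx i j hij
    exact ⟨l, hβ l hl, hne⟩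
  have hRt : Tendsto (corrMatrix kind α x) (𝓝[{β : Fin p → ℝ | ∀ l, 0 ≤ β l}] β₀)
      (𝓝 (corrMatrix kind α x β₀)) := continuousOn_corrMatrix hα x β₀ hβ0
  have hLeq := marginalLikelihood_eq_matrixLikelihood H y hR.det_pos
  obtain ⟨hLfin, hLt⟩ := matrixLikelihood_lt_top_and_tendsto hH hy hR hRt
  have hLpos := matrixLikelihood_pos H y hR.det_pos
  rw [← hLeq] at hLfin hLt hLpos
  have hLt' : Tendsto (marginalLikelihood kind α x H y)
      (𝓝[{β : Fin p → ℝ | ∀ l, 0 ≤ β l}] β₀) (𝓝 (marginalLikelihood kind α x H y β₀)) := by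
    -- The two forms of the likelihood agree where the determinant is positive, hence near `β₀` in
    -- the closed orthant.
    refine hLt.congr' ?_
    filter_upwards [(continuous_id.matrix_det.tendsto _).comp hRt |>.eventually
      (lt_mem_nhds hR.det_pos)] with β h
    exact (marginalLikelihood_eq_matrixLikelihood H y h).symm
  have hπpos : 0 < ENNReal.ofReal (jrPrior a b C β₀) :=
    ENNReal.ofReal_pos.2 (jrPrior_pos ha hb hC hβ0 hβpos)
  have hπt : Tendsto (fun β => ENNReal.ofReal (jrPrior a b C β))
      (𝓝[{β : Fin p → ℝ | ∀ l, 0 ≤ β l}] β₀) (𝓝 (ENNReal.ofReal (jrPrior a b C β₀))) :=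
    ((ENNReal.continuous_ofReal.comp (continuous_jrPrior ha b C)).tendsto β₀).mono_left
      nhdsWithin_le_nhds
  have hpos : 0 < unnormalizedPosterior kind α x H y a b C β₀ :=
    ENNReal.mul_pos hLpos.ne' hπpos.ne'
  have hfin : unnormalizedPosterior kind α x H y a b C β₀ < ∞ :=
    ENNReal.mul_lt_top hLfin ENNReal.ofReal_lt_top
  have ht : Tendsto (unnormalizedPosterior kind α x H y a b C)
      (𝓝[{β : Fin p → ℝ | ∀ l, 0 ≤ β l}] β₀)
      (𝓝 (unnormalizedPosterior kind α x H y a b C β₀)) :=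
    ENNReal.Tendsto.mul hLt' (Or.inl hLpos.ne') hπt (Or.inl hπpos.ne')
  have hmass : posteriorMass kind α x H y a b C ≠ 0 :=
    (setLIntegral_orthant_pos hβ0 hpos ht).ne'
  exact ⟨⟨hpos, hfin, ht⟩, fun hprop => ⟨ENNReal.div_pos hpos.ne' hprop,
    ENNReal.div_lt_top hfin.ne hmass, ENNReal.Tendsto.div_const ht (Or.inl hpos.ne')⟩⟩
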